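/- Let $n\ge 2$ and let $\mathcal M\subset\mathbb R^n$ be a discrete $n$-manifold, i.e. a finite simplicial complex in $\mathbb R^n$, every simplex of which is a face of an $n$-simplex of the complex, whose underlying space is homeomorphic to the closed unit ball $\mathbb B^n$. Let $v_1,\dots,v_N$ be its vertices and $\mathbb S_k(\mathcal M)$ the set of its $k$-simplices; $|\cdot|$ denotes the volume of a simplex in its own dimension (a point has volume $1$). Let $\rho:\mathbb S_n(\mathcal M)\to(0,\infty)$ be a piecewise constant density and $\mu(\sigma)=\rho(\sigma)|\sigma|$. Let $f:\mathcal M\to\mathbb R^n$ be affine on every $n$-simplex and such that $f(\sigma)$ is a nondegenerate $n$-simplex for every $\sigma\in\mathbb S_n(\mathcal M)$ (for instance, $f$ orientation preserving). Put $\mathbf f_i=f(v_i)$ and let $\mathbf f\in\mathbb R^{N\times n}$ be the matrix with rows $\mathbf f_i$. For $i\neq j$ define $$w_{ij}(f)=\frac{1}{n(n-1)}\sum_{\sigma\in\mathbb S_n(\mathcal M):\,v_i,v_j\in\sigma}\frac{|f(\sigma_{\hat i\hat j})|}{\mu(\sigma)/|f(\sigma)|}\,\cot\theta_{ij}^{\sigma}(f),$$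 where $\sigma_{\hat i\hat j}$ is the $(n-2)$-face of $\sigma$ spanned by the vertices other than $v_i,v_j$, and $\theta^\sigma_{ij}(f)\in(0,\pi)$ is the interior dihedral angle of $f(\sigma)$ between its faces opposite to $\mathbf f_i$ and to $\mathbf f_j$. Let $L_V(f)\in\mathbb R^{N\times N}$ be the matrix with $$[L_V(f)]_{ij}=\begin{cases}-w_{ij}(f),&[v_i,v_j]\in\mathbb S_1(\mathcal M),\\ \sum_{\ell\ne i}w_{i\ell}(f),& i=j,\\ 0,&\text{otherwise.}\end{cases}$$ Then the discrete volumetric stretch energy $E_V(f)=\frac1n\operatorname{trace}\big(\mathbf f^\top L_V(f)\,\mathbf f\big)$ satisfies $$E_V(f)=\sum_{\sigma\in\mathbb S_n(\mathcal M)}\frac{|f(\sigma)|^2}{\mu(\sigma)}.$$ -/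

import Mathlib

open MeasureTheory

noncomputable section

/-- A discrete `n`-manifold: a finite simplicial complex in `ℝⁿ` that is a union of `n`-simplices
and whose underlying space is homeomorphic to the closed unit ball of `ℝⁿ`. A simplex is
represented by the finite set of its vertices; as a subset of `ℝⁿ` it is the convex hull of it. -/
structure DiscreteManifold (n : ℕ) where
  complex : Geometry.SimplicialComplex ℝ (EuclideanSpace ℝ (Fin n))
  finite_faces : complex.faces.Finite
  pure : ∀ s ∈ complex.faces, ∃ t ∈ complex.faces, s ⊆ t ∧ t.card = n + 1
  homeo_ball : Nonempty
    (complex.space ≃ₜ Metric.closedBall (0 : EuclideanSpace ℝ (Fin n)) 1)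

/-- The `k`-dimensional volume of a subset of `ℝⁿ`, given by the `k`-dimensional Hausdorff measure
normalized so as to agree with Lebesgue measure on `k`-dimensional Euclidean spaces.
For `k = n` this is Lebesgue measure, and for `k = 0` it counts points. -/
def kVolume {n : ℕ} (k : ℕ) (S : Set (EuclideanSpace ℝ (Fin n))) : ℝ :=
  (μHE[k] S).toReal

/-- The dihedral angle, inside the simplex with vertex set `T`, between the faces opposite to the
vertices `x` and `y`: it is `π` minus the angle between the inward normals of the two faces.
The inward normal of the face opposite to `x` is the altitude vector of `x`, that is, the component
of `x - y` orthogonal to that face (which contains the vertex `y`). -/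
def dihedralAngle {n : ℕ} (T : Set (EuclideanSpace ℝ (Fin n)))
    (x y : EuclideanSpace ℝ (Fin n)) : ℝ :=
  Real.pi - InnerProductGeometry.angle
    ((vectorSpan ℝ (T \ {x}))ᗮ.starProjection (x - y))
    ((vectorSpan ℝ (T \ {y}))ᗮ.starProjection (y - x))

namespace DiscreteManifold

variable {n : ℕ} (M : DiscreteManifold n)

/-- The set `𝕊ₖ(M)` of `k`-simplices. -/
def simplices (k : ℕ) : Finset (Finset (EuclideanSpace ℝ (Fin n))) :=
  (M.finite_faces.subset (Set.sep_subset _ fun s => s.card = k + 1)).toFinset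

instance : Finite M.complex.vertices :=
  Set.Finite.to_subtype
    (M.finite_faces.preimage (Finset.singleton_injective.injOn))

instance : Fintype M.complex.vertices := Fintype.ofFinite _

/-- `f` is affine on every `n`-simplex. Values of `f` outside `M` are irrelevant. -/
def IsPiecewiseAffine
    (f : EuclideanSpace ℝ (Fin n) → EuclideanSpace ℝ (Fin n)) : Prop :=
  ∀ σ ∈ M.simplices n,
    ∃ A : EuclideanSpace ℝ (Fin n) →ᵃ[ℝ] EuclideanSpace ℝ (Fin n),
      Set.EqOn f A (convexHull ℝ (σ : Set (EuclideanSpace ℝ (Fin n))))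

end DiscreteManifold

/-- The mass `μ(σ) = ρ(σ) |σ|` of an `n`-simplex, for a density `ρ` that is constant on each
`n`-simplex. -/
def mass {n : ℕ} (ρ : Finset (EuclideanSpace ℝ (Fin n)) → ℝ)
    (σ : Finset (EuclideanSpace ℝ (Fin n))) : ℝ :=
  ρ σ * kVolume n (convexHull ℝ (σ : Set (EuclideanSpace ℝ (Fin n))))

/-- The volume `|f(σ)|` of the image of an `n`-simplex. -/
def imageVolume {n : ℕ} (f : EuclideanSpace ℝ (Fin n) → EuclideanSpace ℝ (Fin n))
    (σ : Finset (EuclideanSpace ℝ (Fin n))) : ℝ :=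
  kVolume n (f '' convexHull ℝ (σ : Set (EuclideanSpace ℝ (Fin n))))

/-- The stretch factor `μ(σ) / |f(σ)|`. -/
def stretchFactor {n : ℕ} (ρ : Finset (EuclideanSpace ℝ (Fin n)) → ℝ)
    (f : EuclideanSpace ℝ (Fin n) → EuclideanSpace ℝ (Fin n))
    (σ : Finset (EuclideanSpace ℝ (Fin n))) : ℝ :=
  mass ρ σ / imageVolume f σ

namespace DiscreteManifold

variable {n : ℕ} (M : DiscreteManifold n)

open Classical in
/-- The modified cotangent weight `wₓᵧ(f)`: the sum runs over the `n`-simplices `σ` having both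
`x` and `y` as vertices, and `σ \ {x, y}` spans the `(n-2)`-face of `σ` opposite to the edge. -/
def stretchWeight (ρ : Finset (EuclideanSpace ℝ (Fin n)) → ℝ)
    (f : EuclideanSpace ℝ (Fin n) → EuclideanSpace ℝ (Fin n))
    (x y : EuclideanSpace ℝ (Fin n)) : ℝ :=
  1 / ((n : ℝ) * ((n : ℝ) - 1)) *
    ∑ σ ∈ M.simplices n with x ∈ σ ∧ y ∈ σ,
      kVolume (n - 2)
          (f '' convexHull ℝ ((σ : Set (EuclideanSpace ℝ (Fin n))) \ {x, y})) /
        stretchFactor ρ f σ *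
      Real.cot (dihedralAngle (f '' (σ : Set (EuclideanSpace ℝ (Fin n)))) (f x) (f y))

open Classical in
/-- The volumetric stretch Laplacian matrix `L_V(f)`, indexed by the vertices of `M`. -/
def stretchLaplacian (ρ : Finset (EuclideanSpace ℝ (Fin n)) → ℝ)
    (f : EuclideanSpace ℝ (Fin n) → EuclideanSpace ℝ (Fin n)) :
    Matrix M.complex.vertices M.complex.vertices ℝ :=
  Matrix.of fun i j =>
    if i = j then ∑ l with l ≠ i, M.stretchWeight ρ f i l
    else if ({i.1, j.1} : Finset (EuclideanSpace ℝ (Fin n))) ∈ M.simplices 1 then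
      - M.stretchWeight ρ f i j
    else 0

/-- The `N × n` matrix whose rows are the images `f(v)` of the `N` vertices. -/
def vertexMatrix (f : EuclideanSpace ℝ (Fin n) → EuclideanSpace ℝ (Fin n)) :
    Matrix M.complex.vertices (Fin n) ℝ :=
  Matrix.of fun v s => f v s

/-- The discrete volumetric stretch energy `E_V(f) = (1/n) trace (𝐟ᵀ L_V(f) 𝐟)`. -/
def stretchEnergy (ρ : Finset (EuclideanSpace ℝ (Fin n)) → ℝ)
    (f : EuclideanSpace ℝ (Fin n) → EuclideanSpace ℝ (Fin n)) : ℝ :=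
  1 / (n : ℝ) *
    ((M.vertexMatrix f).transpose * M.stretchLaplacian ρ f * M.vertexMatrix f).trace

end DiscreteManifold

end

/-! The quadratic form of a weighted Laplacian is half the sum of `w i j * ‖f i - f j‖ ^ 2`.
Exchanging sums leaves an identity for each image simplex `T` with volume `V`: over ordered pairs,
the sum of (volume of the face opposite `ab`) · cot θ · `‖a - b‖ ^ 2` equals `2n²(n - 1)V`.

Let `g a` be the gradient of the barycentric coordinate at `a`. The altitude vector is `g a / ‖g a‖
^ 2`, so θ is `π` minus the angle between `g a` and `g b`. Building `T` from the face opposite `ab`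
by two cones gives (face volume) · cot θ = `-n(n - 1) V ⟪g a, g b⟫`
(`kVolume_mul_cot_dihedralAngle`). Finally `∑ ⟪g a, g b⟫ ‖a - b‖ ^ 2 = -2n`, by testing the
gradients on an orthonormal basis (`sum_inner_barycentric_gradient_mul_norm_sub_sq`). -/

/-! ### Volumes of cones -/

open scoped Pointwise in
/-- The volume of a cone with apex `0` over the convex hull of a set lying in the hyperplane
`⟪g, ·⟫ = 1`, which has distance `1 / ‖g‖` from the apex. -/
theorem euclideanHausdorffMeasure_convexHull_insert_zero {W : Type*} [NormedAddCommGroup W]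
    [InnerProductSpace ℝ W] [FiniteDimensional ℝ W] [MeasurableSpace W] [BorelSpace W] {k : ℕ}
    (hW : Module.finrank ℝ W = k + 1) {B : Set W} (hB : B.Finite) (hne : B.Nonempty) {g : W}
    (hg : ∀ b ∈ B, inner ℝ g b = 1) :
    μHE[k + 1] (convexHull ℝ (insert 0 B)) =
      ENNReal.ofReal (1 / ((k + 1) * ‖g‖)) * μHE[k] (convexHull ℝ B) := by
  have hg0 : g ≠ 0 := by
    rintro rfl
    obtain ⟨b, hb⟩ := hne
    simpa using hg b hb
  have hgn : 0 < ‖g‖ := norm_pos_iff.2 hg0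
  have hconv : ∀ b ∈ convexHull ℝ B, inner ℝ g b = 1 := by
    have hc : Convex ℝ {y : W | inner ℝ g y = (1 : ℝ)} :=
      convex_hyperplane (f := fun y => inner ℝ g y) (innerₛₗ ℝ g).isLinear _
    intro b hb
    exact convexHull_min hg hc hb
  have hmem : ∀ y, y ∈ convexHull ℝ (insert 0 B) ↔
      ∃ t ∈ Set.Icc (0 : ℝ) 1, ∃ b ∈ convexHull ℝ B, y = t • b := by
    intro y
    rw [convexHull_insert hne, mem_convexJoin]
    constructor
    · rintro ⟨_, rfl, b, hb, a, t, ha, ht, hat, rfl⟩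
      exact ⟨t, ⟨ht, by linarith⟩, b, hb, by simp⟩
    · rintro ⟨t, ⟨h0, h1⟩, b, hb, rfl⟩
      exact ⟨0, rfl, b, hb, 1 - t, t, by linarith, h0, by ring, by simp⟩
  -- The foot of the perpendicular from the apex to the hyperplane; slicing orthogonally to `v`
  -- makes `x` the level of `⟪g, ·⟫`.
  set v : W := (‖g‖ ^ 2)⁻¹ • g with hv
  have hv0 : v ≠ 0 := by simp [hv, hg0]
  have hgv : inner ℝ g v = 1 := by
    rw [hv, inner_smul_right, real_inner_self_eq_norm_sq]
    field_simp
  -- Level `0` meets the cone in the apex, not in `∅`; it is discarded as a null set of levels.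
  have hslice : ∀ x : ℝ, x ≠ 0 →
      convexHull ℝ (insert 0 B) ∩ AffineSubspace.mk' (x • v +ᵥ (0 : W)) (ℝ ∙ v)ᗮ =
        if x ∈ Set.Ioc (0 : ℝ) 1 then x • convexHull ℝ B else ∅ := by
    intro x hx
    have hplane : ∀ y : W, y ∈ AffineSubspace.mk' (x • v +ᵥ (0 : W)) (ℝ ∙ v)ᗮ ↔
        inner ℝ g y = x := by
      intro y
      rw [AffineSubspace.mem_mk', Submodule.mem_orthogonal_singleton_iff_inner_right, hv,
        real_inner_smul_left, ← hv]
      simp only [vadd_eq_add, add_zero, vsub_eq_sub, inner_sub_right, inner_smul_right, hgv]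
      have : (‖g‖ ^ 2)⁻¹ ≠ 0 := by positivity
      simp [this, sub_eq_zero]
    ext y
    rw [Set.mem_inter_iff, SetLike.mem_coe, hplane, hmem]
    constructor
    · rintro ⟨⟨t, ht, b, hb, rfl⟩, hy⟩
      rw [inner_smul_right, hconv b hb, mul_one] at hy
      subst hy
      rw [if_pos ⟨lt_of_le_of_ne ht.1 hx.symm, ht.2⟩]
      exact Set.smul_mem_smul_set hb
    · intro hy
      split_ifs at hy with h
      · obtain ⟨b, hb, rfl⟩ := hy
        exact ⟨⟨x, ⟨h.1.le, h.2⟩, b, hb, rfl⟩, by simp [inner_smul_right, hconv b hb]⟩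
      · exact hy.elim
  have hmeas : MeasurableSet (convexHull ℝ (insert 0 B)) :=
    ((hB.insert 0).isCompact_convexHull ℝ).measurableSet
  have key := EuclideanGeometry.euclideanHausdorffMeasure_eq_lintegral (0 : W) hv0 hmeas
  rw [hW, Nat.add_sub_cancel] at key
  rw [key]
  have hint : ∫⁻ x : ℝ, μHE[k] (convexHull ℝ (insert 0 B) ∩
      (AffineSubspace.mk' (x • v +ᵥ (0 : W)) (ℝ ∙ v)ᗮ : Set W)) =
      ∫⁻ x in Set.Ioc (0 : ℝ) 1, ENNReal.ofReal (x ^ k) * μHE[k] (convexHull ℝ B) := by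
    rw [← lintegral_indicator measurableSet_Ioc]
    refine lintegral_congr_ae ?_
    filter_upwards [Measure.ae_ne volume (0 : ℝ)] with x hx
    rw [hslice x hx, Set.indicator_apply]
    split_ifs with h
    · rw [Measure.euclideanHausdorffMeasure_smul₀ k hx, ENNReal.smul_def, smul_eq_mul,
        ENNReal.ofReal_pow h.1.le, ENNReal.coe_pow, ← enorm_eq_nnnorm, Real.enorm_of_nonneg h.1.le]
    · simp
  have hpow : ∫⁻ x in Set.Ioc (0 : ℝ) 1, ENNReal.ofReal (x ^ k) =
      ENNReal.ofReal (1 / (k + 1)) := by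
    rw [← ofReal_integral_eq_lintegral_ofReal]
    · rw [← intervalIntegral.integral_of_le zero_le_one, integral_pow]
      simp
    · exact (intervalIntegrable_iff_integrableOn_Ioc_of_le zero_le_one).1
        ((continuous_pow k).intervalIntegrable _ _)
    · filter_upwards [ae_restrict_mem measurableSet_Ioc] with x hx
      exact pow_nonneg hx.1.le k
  have hnv : ‖v‖ₑ = ENNReal.ofReal (1 / ‖g‖) := by
    rw [← ofReal_norm, hv, norm_smul, norm_inv, norm_pow, norm_norm]
    congr 1
    field_simp
  rw [hint, lintegral_mul_const _ (by fun_prop), hpow, hnv, ← mul_assoc,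
    ← ENNReal.ofReal_mul (by positivity)]
  congr 2
  field_simp

/-- The volume of a cone contained in a translate of the `(k + 1)`-dimensional subspace `W`. -/
theorem euclideanHausdorffMeasure_convexHull_insert {E : Type*} [NormedAddCommGroup E]
    [InnerProductSpace ℝ E] [FiniteDimensional ℝ E] [MeasurableSpace E] [BorelSpace E] {k : ℕ}
    (W : Submodule ℝ E) (hW : Module.finrank ℝ W = k + 1) {B : Set E} (hB : B.Finite)
    (hne : B.Nonempty) {p g : E} (hgW : g ∈ W) (hpB : ∀ b ∈ B, p - b ∈ W)
    (hg : ∀ b ∈ B, inner ℝ g (p - b) = 1) :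
    μHE[k + 1] (convexHull ℝ (insert p B)) =
      ENNReal.ofReal (1 / ((k + 1) * ‖g‖)) * μHE[k] (convexHull ℝ B) := by
  -- The minus sign sends `0` to the apex and turns `⟪g, p - b⟫ = 1` into the hyperplane condition
  -- in `W`.
  let φ : W →ᵃ[ℝ] E := AffineMap.const ℝ W p - W.subtype.toAffineMap
  have hφ : ∀ w, φ w = p - w := fun w => rfl
  have hiso : Isometry φ := Isometry.of_dist_eq fun x y => by
    rw [hφ, hφ, dist_sub_left]
    rfl
  have hBφ : φ '' (φ ⁻¹' B) = B := by
    refine Set.image_preimage_eq_of_subset fun b hb => ⟨⟨p - b, hpB b hb⟩, ?_⟩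
    simp [hφ]
  have hins : φ '' (insert 0 (φ ⁻¹' B)) = insert p B := by
    rw [Set.image_insert_eq, hBφ, hφ]
    simp
  have hne' : (φ ⁻¹' B).Nonempty := by
    rw [← Set.image_nonempty (f := φ), hBφ]
    exact hne
  have h := euclideanHausdorffMeasure_convexHull_insert_zero hW
    (hB.preimage hiso.injective.injOn) hne' (g := ⟨g, hgW⟩) (fun w hw => by
      have := hg _ hw
      rw [hφ, sub_sub_cancel] at this
      exact this)
  rw [← hiso.euclideanHausdorffMeasure_image, ← hiso.euclideanHausdorffMeasure_image (d := k),
    AffineMap.image_convexHull, AffineMap.image_convexHull, hBφ, hins] at h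
  exact h

/-! ### Barycentric gradients -/

/-- The gradients of the barycentric coordinates of a simplex are inverse to its altitude
vectors. -/
theorem AffineIndependent.exists_barycentric_gradient {E : Type*} [NormedAddCommGroup E]
    [InnerProductSpace ℝ E] [FiniteDimensional ℝ E] {T : Finset E}
    (hT : AffineIndependent ℝ ((↑) : T → E)) :
    ∃ g : E → E, ∀ a ∈ T, ∀ b ∈ T, b ≠ a → inner ℝ (g a) (a - b) = 1 ∧
      ((vectorSpan ℝ ((T : Set E) \ {a}))ᗮ).starProjection (a - b) = (‖g a‖ ^ 2)⁻¹ • g a := by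
  have main : ∀ a ∈ T, ∃ g : E, ∀ b ∈ T, b ≠ a → inner ℝ g (a - b) = 1 ∧
      ((vectorSpan ℝ ((T : Set E) \ {a}))ᗮ).starProjection (a - b) = (‖g‖ ^ 2)⁻¹ • g := by
    intro a ha
    by_cases hne : ∃ b ∈ T, b ≠ a
    · obtain ⟨b, hb, hba⟩ := hne
      set S := vectorSpan ℝ ((T : Set E) \ {a}) with hS
      set u := Sᗮ.starProjection (a - b) with hu
      have huS : u ∈ Sᗮ := Submodule.starProjection_apply_mem _ _
      -- A zero altitude would put `a` in the affine span of the other vertices.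
      have hu0 : u ≠ 0 := by
        intro h0
        rw [hu, Submodule.starProjection_apply_eq_zero_iff, Submodule.orthogonal_orthogonal] at h0
        have hnot := hT.notMem_affineSpan_sdiff ⟨a, ha⟩ Set.univ
        apply hnot
        have himg : ((↑) : T → E) '' (Set.univ \ {⟨a, ha⟩}) = (T : Set E) \ {a} := by
          ext x
          simp [and_comm]
        rw [himg]
        have hbm : b ∈ affineSpan ℝ ((T : Set E) \ {a}) :=
          subset_affineSpan _ _ ⟨hb, hba⟩
        have := AffineSubspace.vadd_mem_of_mem_direction
          (s := affineSpan ℝ ((T : Set E) \ {a})) (by rwa [direction_affineSpan]) hbm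
        simpa using this
      have hproj : ∀ c ∈ T, c ≠ a → Sᗮ.starProjection (a - c) = u := by
        intro c hc hca
        have h1 : b - c ∈ S := vsub_mem_vectorSpan ℝ (Set.mem_sdiff_singleton.2 ⟨hb, hba⟩)
          (Set.mem_sdiff_singleton.2 ⟨hc, hca⟩)
        rw [← sub_add_sub_cancel a b c, map_add,
          (Submodule.starProjection_apply_eq_zero_iff Sᗮ (v := b - c)).2
            (by rwa [Submodule.orthogonal_orthogonal]), add_zero]
      have hun : ‖u‖ ≠ 0 := norm_ne_zero_iff.2 hu0
      refine ⟨(‖u‖ ^ 2)⁻¹ • u, fun c hc hca => ⟨?_, ?_⟩⟩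
      · have h2 : inner ℝ u (a - c) = ‖u‖ ^ 2 := by
          rw [← real_inner_self_eq_norm_sq]
          nth_rewrite 3 [← hproj c hc hca]
          rw [← Submodule.inner_starProjection_left_eq_right,
            Submodule.starProjection_eq_self_iff.2 huS]
        rw [real_inner_smul_left, h2]
        field_simp
      · rw [hproj c hc hca, smul_smul, norm_smul, norm_inv, norm_pow, norm_norm]
        have : ((‖u‖ ^ 2)⁻¹ * ‖u‖) ^ 2 = (‖u‖ ^ 2)⁻¹ := by field_simp
        rw [this, inv_inv, mul_inv_cancel₀ (pow_ne_zero 2 hun), one_smul]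
    · push Not at hne
      exact ⟨0, fun b hb hba => (hba (hne b hb)).elim⟩
  choose! g hg using main
  exact ⟨g, hg⟩

/-- For fixed `y` the coefficients `⟪g a, y⟫` have sum zero and represent `y` as a combination of
vertices. Expanding `‖a - b‖ ^ 2` then leaves only the cross term, `-2 * ‖y‖ ^ 2`; Parseval sums
this over an orthonormal basis. -/
theorem sum_inner_barycentric_gradient_mul_norm_sub_sq {E : Type*} [NormedAddCommGroup E]
    [InnerProductSpace ℝ E] [FiniteDimensional ℝ E] {T : Finset E}
    (hT : vectorSpan ℝ (T : Set E) = ⊤) {g : E → E}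
    (hg : ∀ a ∈ T, ∀ b ∈ T, b ≠ a → inner ℝ (g a) (a - b) = 1) :
    ∑ a ∈ T, ∑ b ∈ T, inner ℝ (g a) (g b) * ‖a - b‖ ^ 2 = -2 * (Module.finrank ℝ E : ℝ) := by
  classical
  have hdiff : ∀ a ∈ T, ∀ c ∈ T, ∀ d ∈ T, inner ℝ (g a) (c - d) =
      (if a = c then (1 : ℝ) else 0) - if a = d then 1 else 0 := by
    intro a ha c hc d hd
    by_cases hac : a = c <;> by_cases had : a = d
    · simp [← hac, ← had]
    · subst hac
      simp [had, hg a ha d hd (Ne.symm had)]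
    · subst had
      rw [← neg_sub, inner_neg_right, hg a ha c hc (Ne.symm hac)]
      simp [hac]
    · rw [← sub_sub_sub_cancel_left d c a, inner_sub_right, hg a ha c hc (Ne.symm hac),
        hg a ha d hd (Ne.symm had)]
      simp [hac, had]
  -- Both identities are linear in `y`, so vertex differences, which span, suffice.
  have hrep : ∀ y : E, ∑ a ∈ T, inner ℝ (g a) y = 0 ∧ ∑ a ∈ T, inner ℝ (g a) y • a = y := by
    intro y
    have hy : y ∈ Submodule.span ℝ ((T : Set E) -ᵥ (T : Set E)) := by
      rw [← vectorSpan_def, hT]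
      trivial
    induction hy using Submodule.span_induction with
    | mem x hx =>
      obtain ⟨c, hc, d, hd, rfl⟩ := hx
      rw [Finset.mem_coe] at hc hd
      simp only [vsub_eq_sub]
      rw [Finset.sum_congr rfl fun a ha => hdiff a ha c hc d hd,
        Finset.sum_congr rfl fun a ha => congrArg (· • a) (hdiff a ha c hc d hd)]
      simp [sub_smul, hc, hd]
    | zero => simp
    | add x y _ _ hx hy =>
      simp [inner_add_right, add_smul, Finset.sum_add_distrib, hx.1, hx.2, hy.1, hy.2]
    | smul r x _ hx =>
      simp only [real_inner_smul_right, mul_smul, ← Finset.mul_sum, ← Finset.smul_sum, hx.1, hx.2]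
      simp
  have hquad : ∀ y : E, ∑ a ∈ T, ∑ b ∈ T, (inner ℝ (g a) y * inner ℝ y (g b)) * ‖a - b‖ ^ 2 =
      -2 * ‖y‖ ^ 2 := by
    intro y
    obtain ⟨h0, h1⟩ := hrep y
    have hin : ∑ a ∈ T, ∑ b ∈ T, inner ℝ (g a) y * inner ℝ (g b) y * inner ℝ a b = ‖y‖ ^ 2 := by
      have hyy : inner ℝ (∑ a ∈ T, inner ℝ (g a) y • a) (∑ b ∈ T, inner ℝ (g b) y • b) =
          ‖y‖ ^ 2 := by
        rw [h1, real_inner_self_eq_norm_sq]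
      rw [← hyy, sum_inner]
      refine Finset.sum_congr rfl fun a _ => ?_
      rw [inner_sum]
      refine Finset.sum_congr rfl fun b _ => ?_
      rw [real_inner_smul_left, real_inner_smul_right, mul_assoc]
    calc ∑ a ∈ T, ∑ b ∈ T, (inner ℝ (g a) y * inner ℝ y (g b)) * ‖a - b‖ ^ 2
        = ∑ a ∈ T, ∑ b ∈ T, ((inner ℝ (g a) y * ‖a‖ ^ 2) * inner ℝ (g b) y
            + inner ℝ (g a) y * (inner ℝ (g b) y * ‖b‖ ^ 2)
            - 2 * (inner ℝ (g a) y * inner ℝ (g b) y * inner ℝ a b)) := by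
          refine Finset.sum_congr rfl fun a _ => Finset.sum_congr rfl fun b _ => ?_
          rw [norm_sub_sq_real, real_inner_comm (g b) y]
          ring
      _ = -2 * ‖y‖ ^ 2 := by
          simp only [Finset.sum_sub_distrib, Finset.sum_add_distrib, ← Finset.mul_sum,
            ← Finset.sum_mul, h0, hin]
          ring
  let e := stdOrthonormalBasis ℝ E
  calc ∑ a ∈ T, ∑ b ∈ T, inner ℝ (g a) (g b) * ‖a - b‖ ^ 2
      = ∑ a ∈ T, ∑ b ∈ T, ∑ i, (inner ℝ (g a) (e i) * inner ℝ (e i) (g b)) * ‖a - b‖ ^ 2 := by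
        refine Finset.sum_congr rfl fun a _ => Finset.sum_congr rfl fun b _ => ?_
        rw [← Finset.sum_mul, e.sum_inner_mul_inner]
    _ = ∑ i, ∑ a ∈ T, ∑ b ∈ T, (inner ℝ (g a) (e i) * inner ℝ (e i) (g b)) * ‖a - b‖ ^ 2 := by
        rw [Finset.sum_comm]
        rw [Finset.sum_congr rfl fun b _ => Finset.sum_comm]
        rw [Finset.sum_comm]
        exact Finset.sum_congr rfl fun i _ => Finset.sum_comm
    _ = -2 * (Module.finrank ℝ E : ℝ) := by
        simp only [hquad, e.norm_eq_one]
        simp [mul_comm]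

/-! ### The cotangent formula for one simplex -/

theorem kVolume_mul_cot_dihedralAngle {m : ℕ} {T : Finset (EuclideanSpace ℝ (Fin (m + 2)))}
    (hT : 3 ≤ T.card) {g : EuclideanSpace ℝ (Fin (m + 2)) → EuclideanSpace ℝ (Fin (m + 2))}
    (hg : ∀ a ∈ T, ∀ b ∈ T, b ≠ a → inner ℝ (g a) (a - b) = 1 ∧
      ((vectorSpan ℝ ((T : Set (EuclideanSpace ℝ (Fin (m + 2)))) \ {a}))ᗮ).starProjection (a - b)
        = (‖g a‖ ^ 2)⁻¹ • g a) {a b : EuclideanSpace ℝ (Fin (m + 2))} (ha : a ∈ T) (hb : b ∈ T)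
    (hab : a ≠ b) :
    kVolume m (convexHull ℝ ((T : Set (EuclideanSpace ℝ (Fin (m + 2)))) \ {a, b})) *
      Real.cot (dihedralAngle (T : Set (EuclideanSpace ℝ (Fin (m + 2)))) a b) =
      -((m + 2) * (m + 1)) *
        kVolume (m + 2) (convexHull ℝ (T : Set (EuclideanSpace ℝ (Fin (m + 2))))) *
          inner ℝ (g a) (g b) := by
  have hgne : ∀ x ∈ T, ∀ y ∈ T, y ≠ x → g x ≠ 0 := by
    intro x hx y hy hyx h0
    simpa [h0] using (hg x hx y hy hyx).1
  have hga : g a ≠ 0 := hgne a ha b hb hab.symm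
  have hgb : g b ≠ 0 := hgne b hb a ha hab
  have hna : 0 < ‖g a‖ := norm_pos_iff.2 hga
  have hnb : 0 < ‖g b‖ := norm_pos_iff.2 hgb
  have hangle : dihedralAngle (T : Set (EuclideanSpace ℝ (Fin (m + 2)))) a b =
      Real.pi - InnerProductGeometry.angle (g a) (g b) := by
    rw [dihedralAngle, (hg a ha b hb hab.symm).2, (hg b hb a ha hab).2,
      InnerProductGeometry.angle_smul_left_of_pos _ _ (by positivity),
      InnerProductGeometry.angle_smul_right_of_pos _ _ (by positivity)]
  set F := (T : Set (EuclideanSpace ℝ (Fin (m + 2)))) with hF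
  -- A third vertex makes the base of the second cone nonempty and forces `h ≠ 0`.
  obtain ⟨c, hc⟩ : (F \ {a, b}).Nonempty := by
    classical
    have h2 : 0 < (T \ {a, b}).card := by
      have := Finset.le_card_sdiff {a, b} T
      have := Finset.card_le_two (a := a) (b := b)
      omega
    obtain ⟨c, hc⟩ := Finset.card_pos.1 h2
    exact ⟨c, by simpa [hF] using hc⟩
  have hmem : ∀ x ∈ F \ {a, b}, x ∈ T ∧ x ≠ a ∧ x ≠ b := by
    intro x hx
    simpa [hF] using hx
  have hvol1 : kVolume (m + 2) (convexHull ℝ F) =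
      1 / ((m + 2) * ‖g b‖) * kVolume (m + 1) (convexHull ℝ (F \ {b})) := by
    have h := euclideanHausdorffMeasure_convexHull_insert (k := m + 1)
      (⊤ : Submodule ℝ (EuclideanSpace ℝ (Fin (m + 2)))) (by simp)
      (B := F \ {b}) (T.finite_toSet.sdiff) ⟨a, ha, by simpa using hab⟩ (p := b) (g := g b)
      trivial (fun _ _ => trivial) (fun x hx => (hg b hb x hx.1 hx.2).1)
    rw [Set.insert_sdiff_singleton, Set.insert_eq_of_mem (show b ∈ F from hb)] at h
    rw [kVolume, kVolume, h, ENNReal.toReal_mul, ENNReal.toReal_ofReal (by positivity)]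
    push_cast
    ring
  -- The part of `g a` orthogonal to `g b` is the gradient, within the facet opposite `b`, of the
  -- coordinate of `a`; its norm is `‖g a‖` times the sine of the angle.
  set h := g a - (inner ℝ (g b) (g a) / ‖g b‖ ^ 2) • g b with hh
  have horth : inner ℝ (g b) h = 0 := by
    rw [hh, inner_sub_right, inner_smul_right, real_inner_self_eq_norm_sq]
    field_simp
    ring
  have hperp : ∀ x ∈ F \ {a, b}, inner ℝ (g b) (a - x) = 0 := by
    intro x hx
    obtain ⟨h1, -, h3⟩ := hmem x hx
    rw [← sub_sub_sub_cancel_left x a b, inner_sub_right, (hg b hb x h1 h3).1, (hg b hb a ha hab).1,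
      sub_self]
  have hdual : ∀ x ∈ F \ {a, b}, inner ℝ h (a - x) = 1 := by
    intro x hx
    obtain ⟨h1, h2, -⟩ := hmem x hx
    rw [hh, inner_sub_left, real_inner_smul_left, hperp x hx, (hg a ha x h1 h2).1]
    ring
  have hvol2 : kVolume (m + 1) (convexHull ℝ (F \ {b})) =
      1 / ((m + 1) * ‖h‖) * kVolume m (convexHull ℝ (F \ {a, b})) := by
    have hrank : Module.finrank ℝ ((ℝ ∙ g b)ᗮ : Submodule ℝ _) = m + 1 := by
      have := Submodule.finrank_add_finrank_orthogonal (ℝ ∙ g b)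
      rw [finrank_span_singleton hgb, finrank_euclideanSpace_fin] at this
      omega
    have hv := euclideanHausdorffMeasure_convexHull_insert (k := m) (ℝ ∙ g b)ᗮ hrank
      (B := F \ {a, b}) (T.finite_toSet.sdiff) ⟨c, hc⟩ (p := a) (g := h)
      (Submodule.mem_orthogonal_singleton_iff_inner_right.2 horth)
      (fun x hx => Submodule.mem_orthogonal_singleton_iff_inner_right.2 (hperp x hx)) hdual
    have hset : insert a (F \ {a, b}) = F \ {b} := by
      ext x
      have haF : a ∈ F := ha
      by_cases hxa : x = a
      · simp [hxa, haF, hab]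
      · simp [hxa]
    rw [hset] at hv
    rw [kVolume, kVolume, hv, ENNReal.toReal_mul, ENNReal.toReal_ofReal (by positivity)]
  have hh0 : 0 < ‖h‖ := by
    rw [norm_pos_iff]
    intro h0
    simpa [h0] using hdual c hc
  set s := Real.sin (InnerProductGeometry.angle (g a) (g b)) with hs
  have hsin : ‖h‖ = s * ‖g a‖ := by
    have h1 : ‖h‖ ^ 2 = (s * ‖g a‖) ^ 2 := by
      rw [← real_inner_self_eq_norm_sq, mul_pow, hs, Real.sin_sq, InnerProductGeometry.cos_angle]
      nth_rewrite 1 [hh]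
      rw [inner_sub_left, real_inner_smul_left, horth, hh, inner_sub_right, inner_smul_right,
        real_inner_self_eq_norm_sq, real_inner_comm (g a) (g b)]
      field_simp
      ring
    have hs0 : 0 ≤ s := InnerProductGeometry.sin_angle_nonneg _ _
    exact (sq_eq_sq₀ (norm_nonneg _) (by positivity)).1 h1
  have hs0 : s ≠ 0 := by
    intro h0
    rw [h0, zero_mul] at hsin
    exact hh0.ne' hsin
  rw [hangle, Real.cot_eq_cos_div_sin, Real.cos_pi_sub, Real.sin_pi_sub,
    InnerProductGeometry.cos_angle, ← hs, hvol1, hvol2, hsin]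
  field_simp

/-- The hull has an interior point, and a small step from it along a kernel vector of the linear
part would stay inside without changing the value. -/
theorem AffineMap.injective_of_injOn_convexHull {E F : Type*} [NormedAddCommGroup E]
    [NormedSpace ℝ E] [FiniteDimensional ℝ E] [AddCommGroup F] [Module ℝ F] {S : Set E}
    (hS : affineSpan ℝ S = ⊤) {A : E →ᵃ[ℝ] F} (hA : Set.InjOn A (convexHull ℝ S)) :
    Function.Injective A := by
  obtain ⟨z, hz⟩ := interior_convexHull_nonempty_iff_affineSpan_eq_top.2 hS
  rw [← A.linear_injective_iff, injective_iff_map_eq_zero]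
  intro v hv
  have hlim : Filter.Tendsto (fun t : ℝ => z + t • v) (nhdsWithin 0 {0}ᶜ) (nhds z) := by
    have : Continuous fun t : ℝ => z + t • v := by fun_prop
    simpa using (this.tendsto 0).mono_left nhdsWithin_le_nhds
  obtain ⟨t, ht, ht0⟩ := ((hlim.eventually (mem_interior_iff_mem_nhds.1 hz)).and
    self_mem_nhdsWithin).exists
  have heq : A (z + t • v) = A z := by
    rw [add_comm, ← vadd_eq_add, A.map_vadd, map_smul, hv, smul_zero, zero_vadd]
  have := hA ht (interior_subset hz) heq
  rw [add_eq_left, smul_eq_zero] at this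
  exact this.resolve_left ht0

/-- The cotangent formula for the volume of a nondegenerate simplex. -/
theorem sum_kVolume_mul_cot_dihedralAngle {m : ℕ} {T : Finset (EuclideanSpace ℝ (Fin (m + 2)))}
    (hT : AffineIndependent ℝ ((↑) : T → EuclideanSpace ℝ (Fin (m + 2))))
    (hcard : T.card = m + 3) :
    ∑ a ∈ T, ∑ b ∈ T,
      kVolume m (convexHull ℝ ((T : Set (EuclideanSpace ℝ (Fin (m + 2)))) \ {a, b})) *
        Real.cot (dihedralAngle (T : Set (EuclideanSpace ℝ (Fin (m + 2)))) a b) * ‖a - b‖ ^ 2 =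
      2 * (m + 2) ^ 2 * (m + 1) *
        kVolume (m + 2) (convexHull ℝ (T : Set (EuclideanSpace ℝ (Fin (m + 2))))) := by
  obtain ⟨g, hg⟩ := hT.exists_barycentric_gradient
  have hspan : vectorSpan ℝ (T : Set (EuclideanSpace ℝ (Fin (m + 2)))) = ⊤ := by
    have := hT.vectorSpan_eq_top_of_card_eq_finrank_add_one (by simp [hcard])
    simpa using this
  have hsum := sum_inner_barycentric_gradient_mul_norm_sub_sq hspan
    fun a ha b hb hba => (hg a ha b hb hba).1
  set V := kVolume (m + 2) (convexHull ℝ (T : Set (EuclideanSpace ℝ (Fin (m + 2)))))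
  calc _ = ∑ a ∈ T, ∑ b ∈ T, -((m + 2) * (m + 1)) * V * (inner ℝ (g a) (g b) * ‖a - b‖ ^ 2) := by
        refine Finset.sum_congr rfl fun a ha => Finset.sum_congr rfl fun b hb => ?_
        by_cases hab : a = b
        -- On the diagonal the squared distance vanishes, whatever the angle term is.
        · simp [hab]
        · rw [kVolume_mul_cot_dihedralAngle (by omega) hg ha hb hab, mul_assoc]
    _ = _ := by
        simp only [← Finset.mul_sum]
        rw [hsum, finrank_euclideanSpace_fin]
        push_cast
        ring

theorem sum_kVolume_image_mul_cot_dihedralAngle {n : ℕ} (hn : 2 ≤ n)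
    {σ : Finset (EuclideanSpace ℝ (Fin n))}
    (hσ : AffineIndependent ℝ ((↑) : σ → EuclideanSpace ℝ (Fin n))) (hcard : σ.card = n + 1)
    {f : EuclideanSpace ℝ (Fin n) → EuclideanSpace ℝ (Fin n)}
    {A : EuclideanSpace ℝ (Fin n) →ᵃ[ℝ] EuclideanSpace ℝ (Fin n)}
    (hfA : Set.EqOn f A (convexHull ℝ (σ : Set (EuclideanSpace ℝ (Fin n)))))
    (hinj : Set.InjOn f (convexHull ℝ (σ : Set (EuclideanSpace ℝ (Fin n))))) :
    ∑ x ∈ σ, ∑ y ∈ σ,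
      kVolume (n - 2) (f '' convexHull ℝ ((σ : Set (EuclideanSpace ℝ (Fin n))) \ {x, y})) *
        Real.cot (dihedralAngle (f '' (σ : Set (EuclideanSpace ℝ (Fin n)))) (f x) (f y)) *
          ‖f x - f y‖ ^ 2 =
      2 * (n : ℝ) ^ 2 * (n - 1) * imageVolume f σ := by
  classical
  obtain ⟨m, rfl⟩ := Nat.exists_eq_add_of_le' hn
  have hspan : affineSpan ℝ (σ : Set (EuclideanSpace ℝ (Fin (m + 2)))) = ⊤ := by
    have := hσ.affineSpan_eq_top_iff_card_eq_finrank_add_one.2 (by simp [hcard])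
    simpa using this
  have hA : Function.Injective A :=
    AffineMap.injective_of_injOn_convexHull hspan (hinj.congr hfA)
  have hsub : (σ : Set (EuclideanSpace ℝ (Fin (m + 2)))) ⊆ convexHull ℝ σ := subset_convexHull ℝ _
  have hfσ : f '' (σ : Set (EuclideanSpace ℝ (Fin (m + 2)))) = (σ.image A : Finset _) := by
    rw [(hfA.mono hsub).image_eq, Finset.coe_image]
  have hdiff : ∀ x y, f '' convexHull ℝ ((σ : Set (EuclideanSpace ℝ (Fin (m + 2)))) \ {x, y}) =
      convexHull ℝ (((σ.image A : Finset _) : Set (EuclideanSpace ℝ (Fin (m + 2)))) \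
        {A x, A y}) := by
    intro x y
    rw [(hfA.mono (convexHull_mono Set.sdiff_subset)).image_eq, AffineMap.image_convexHull,
      Set.image_sdiff hA, Set.image_pair, Finset.coe_image]
  have hTind : AffineIndependent ℝ ((↑) : σ.image A → EuclideanSpace ℝ (Fin (m + 2))) := by
    have h1 := (hσ.map' A hA).range
    have h2 : Set.range (A ∘ ((↑) : σ → EuclideanSpace ℝ (Fin (m + 2)))) =
        ((σ.image A : Finset _) : Set (EuclideanSpace ℝ (Fin (m + 2)))) := by
      rw [Set.range_comp, Subtype.range_coe_subtype, Finset.coe_image]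
      rfl
    rw [h2] at h1
    exact h1
  have key := sum_kVolume_mul_cot_dihedralAngle hTind (by
    rw [Finset.card_image_of_injective _ hA, hcard])
  rw [Finset.sum_image hA.injOn] at key
  have hvol : imageVolume f σ = kVolume (m + 2) (convexHull ℝ
      ((σ.image A : Finset _) : Set (EuclideanSpace ℝ (Fin (m + 2))))) := by
    rw [imageVolume, hfA.image_eq, AffineMap.image_convexHull, Finset.coe_image]
  rw [hvol]
  calc _ = _ := Finset.sum_congr rfl fun x hx => by
          rw [Finset.sum_image hA.injOn]
          refine Finset.sum_congr rfl fun y hy => ?_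
          rw [hdiff, hfσ, hfA (hsub hx), hfA (hsub hy), Nat.add_sub_cancel]
    _ = _ := key
    _ = _ := by push_cast; ring

/-! ### From the Laplacian to a sum over simplices -/

/-- The quadratic form of a weighted graph Laplacian. -/
theorem sum_laplacian_mul_inner {ι E : Type*} [Fintype ι] [DecidableEq ι] [NormedAddCommGroup E]
    [InnerProductSpace ℝ E] (w L : ι → ι → ℝ) (hw : ∀ i j, w i j = w j i)
    (hL : ∀ i j, i ≠ j → L i j = -w i j) (hL' : ∀ i, L i i = ∑ l with l ≠ i, w i l) (x : ι → E) :
    ∑ i, ∑ j, L i j * inner ℝ (x i) (x j) = 1 / 2 * ∑ i, ∑ j, w i j * ‖x i - x j‖ ^ 2 := by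
  -- The value `w i i` is immaterial: its factor on the right is zero.
  have h1 : ∀ i, ∑ j, L i j * inner ℝ (x i) (x j) =
      ∑ j, w i j * (‖x i‖ ^ 2 - inner ℝ (x i) (x j)) := by
    intro i
    rw [← Finset.add_sum_erase _ _ (Finset.mem_univ i),
      ← Finset.add_sum_erase (a := i) _ (fun j => w i j * _) (Finset.mem_univ i), hL',
      real_inner_self_eq_norm_sq, sub_self, mul_zero, zero_add, Finset.filter_ne', Finset.sum_mul,
      ← Finset.sum_add_distrib]
    refine Finset.sum_congr rfl fun j hj => ?_
    rw [hL i j (Finset.ne_of_mem_erase hj).symm]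
    ring
  have h2 : ∑ i, ∑ j, w i j * (‖x i‖ ^ 2 - inner ℝ (x i) (x j)) =
      ∑ i, ∑ j, w i j * (‖x j‖ ^ 2 - inner ℝ (x i) (x j)) := by
    rw [Finset.sum_comm]
    refine Finset.sum_congr rfl fun j _ => Finset.sum_congr rfl fun i _ => ?_
    rw [hw, real_inner_comm]
  have h3 : ∑ i, ∑ j, w i j * ‖x i - x j‖ ^ 2 =
      ∑ i, ∑ j, w i j * (‖x i‖ ^ 2 - inner ℝ (x i) (x j)) +
        ∑ i, ∑ j, w i j * (‖x j‖ ^ 2 - inner ℝ (x i) (x j)) := by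
    simp only [← Finset.sum_add_distrib]
    refine Finset.sum_congr rfl fun i _ => Finset.sum_congr rfl fun j _ => ?_
    rw [norm_sub_sq_real]
    ring
  rw [Finset.sum_congr rfl fun i _ => h1 i, h3, ← h2]
  ring

theorem dihedralAngle_comm {n : ℕ} (T : Set (EuclideanSpace ℝ (Fin n)))
    (x y : EuclideanSpace ℝ (Fin n)) : dihedralAngle T x y = dihedralAngle T y x := by
  rw [dihedralAngle, dihedralAngle, InnerProductGeometry.angle_comm]

namespace DiscreteManifold

variable {n : ℕ} (M : DiscreteManifold n)

theorem mem_simplices {k : ℕ} {σ : Finset (EuclideanSpace ℝ (Fin n))} :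
    σ ∈ M.simplices k ↔ σ ∈ M.complex.faces ∧ σ.card = k + 1 := by
  simp [simplices]

variable (ρ : Finset (EuclideanSpace ℝ (Fin n)) → ℝ)
  (f : EuclideanSpace ℝ (Fin n) → EuclideanSpace ℝ (Fin n))

theorem stretchWeight_comm (x y : EuclideanSpace ℝ (Fin n)) :
    M.stretchWeight ρ f x y = M.stretchWeight ρ f y x := by
  rw [stretchWeight, stretchWeight]
  congr 1
  simp only [and_comm (a := x ∈ _), Set.pair_comm x y, dihedralAngle_comm _ (f x) (f y)]

/-- Two vertices of a common simplex span an edge, so without an edge the sum is empty. Hence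
off-diagonal Laplacian entries are `-w` even where they are set to `0`. -/
theorem stretchWeight_eq_zero {x y : EuclideanSpace ℝ (Fin n)} (hxy : x ≠ y)
    (h : ∀ s ∈ M.simplices 1, ¬ (x ∈ s ∧ y ∈ s)) : M.stretchWeight ρ f x y = 0 := by
  classical
  rw [stretchWeight, Finset.filter_false_of_mem, Finset.sum_empty, mul_zero]
  rintro σ hσ ⟨hx, hy⟩
  refine h {x, y} (M.mem_simplices.2 ⟨?_, Finset.card_pair hxy⟩) (by simp)
  exact M.complex.down_closed (M.mem_simplices.1 hσ).1
    (by simp [Finset.insert_subset_iff, hx, hy]) (by simp)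

/-- The stretch energy as a weighted sum of squared edge lengths. -/
theorem stretchEnergy_eq_sum_norm_sub_sq :
    M.stretchEnergy ρ f = 1 / (n : ℝ) * (1 / 2 * ∑ i : M.complex.vertices,
      ∑ j : M.complex.vertices, M.stretchWeight ρ f i j * ‖f i - f j‖ ^ 2) := by
  classical
  rw [← sum_laplacian_mul_inner (fun i j : M.complex.vertices => M.stretchWeight ρ f i j)
    (M.stretchLaplacian ρ f) (fun i j => M.stretchWeight_comm ρ f i j) ?_ ?_
    (fun i => f i), stretchEnergy]
  · congr 1
    simp only [Matrix.trace, Matrix.diag, Matrix.mul_apply, Matrix.transpose_apply, vertexMatrix,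
      Matrix.of_apply, PiLp.inner_apply, RCLike.inner_apply, conj_trivial, Finset.sum_mul,
      Finset.mul_sum]
    rw [Finset.sum_comm]
    rw [Finset.sum_congr rfl fun j _ => Finset.sum_comm]
    rw [Finset.sum_comm]
    refine Finset.sum_congr rfl fun i _ => Finset.sum_congr rfl fun j _ =>
      Finset.sum_congr rfl fun s _ => ?_
    ring
  · intro i j hij
    simp only [stretchLaplacian, Matrix.of_apply, if_neg hij]
    split_ifs with h
    · rfl
    · rw [stretchWeight_eq_zero, neg_zero]
      · exact fun h' => hij (Subtype.ext h')
      · rintro s hs ⟨hi, hj⟩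
        apply h
        have hs2 := (M.mem_simplices.1 hs).2
        have : ({i.1, j.1} : Finset (EuclideanSpace ℝ (Fin n))) = s := by
          refine Finset.eq_of_subset_of_card_le (by simp [Finset.insert_subset_iff, hi, hj]) ?_
          rw [hs2, Finset.card_pair fun h' => hij (Subtype.ext h')]
        convert hs
  · intro i
    simp only [stretchLaplacian, Matrix.of_apply, if_pos]

theorem sum_vertices_ite_mem {σ : Finset (EuclideanSpace ℝ (Fin n))} (hσ : σ ∈ M.complex.faces)
    [DecidablePred (· ∈ σ)] (φ : EuclideanSpace ℝ (Fin n) → ℝ) :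
    ∑ i : M.complex.vertices, (if i.1 ∈ σ then φ i else 0) = ∑ x ∈ σ, φ x := by
  classical
  rw [← Finset.sum_filter]
  refine Finset.sum_bij (fun i _ => i.1) (by simp) (fun _ _ _ _ => Subtype.ext) ?_ (by simp)
  intro x hx
  have hxv : x ∈ M.complex.vertices :=
    M.complex.down_closed hσ (Finset.singleton_subset_iff.2 hx) (Finset.singleton_nonempty x)
  exact ⟨⟨x, hxv⟩, by simpa using hx, rfl⟩

theorem sum_stretchWeight_mul (c : EuclideanSpace ℝ (Fin n) → EuclideanSpace ℝ (Fin n) → ℝ) :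
    ∑ i : M.complex.vertices, ∑ j : M.complex.vertices, M.stretchWeight ρ f i j * c i j =
      1 / ((n : ℝ) * ((n : ℝ) - 1)) * ∑ σ ∈ M.simplices n, 1 / stretchFactor ρ f σ *
        ∑ x ∈ σ, ∑ y ∈ σ,
          kVolume (n - 2) (f '' convexHull ℝ ((σ : Set (EuclideanSpace ℝ (Fin n))) \ {x, y})) *
            Real.cot (dihedralAngle (f '' (σ : Set (EuclideanSpace ℝ (Fin n)))) (f x) (f y)) *
              c x y := by
  classical
  let t := fun (σ : Finset (EuclideanSpace ℝ (Fin n))) (x y : EuclideanSpace ℝ (Fin n)) =>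
    kVolume (n - 2) (f '' convexHull ℝ ((σ : Set (EuclideanSpace ℝ (Fin n))) \ {x, y})) *
      Real.cot (dihedralAngle (f '' (σ : Set (EuclideanSpace ℝ (Fin n)))) (f x) (f y)) * c x y
  have h1 : ∀ x y, M.stretchWeight ρ f x y * c x y = ∑ σ ∈ M.simplices n,
      1 / ((n : ℝ) * ((n : ℝ) - 1)) * (1 / stretchFactor ρ f σ *
        if x ∈ σ then if y ∈ σ then t σ x y else 0 else 0) := by
    intro x y
    rw [stretchWeight, mul_assoc, Finset.sum_mul, Finset.sum_filter, Finset.mul_sum]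
    refine Finset.sum_congr (by congr) fun σ _ => ?_
    congr 1
    by_cases hx : x ∈ σ <;> by_cases hy : y ∈ σ <;> simp only [hx, hy, t, and_true, and_false,
      and_self, if_true, if_false, mul_zero]
    ring
  simp only [h1]
  rw [Finset.sum_congr rfl fun i _ => Finset.sum_comm, Finset.sum_comm, Finset.mul_sum]
  refine Finset.sum_congr rfl fun σ hσ => ?_
  have hface := (M.mem_simplices.1 hσ).1
  simp only [← Finset.mul_sum]
  congr 2
  rw [← M.sum_vertices_ite_mem hface]
  refine Finset.sum_congr rfl fun i _ => ?_
  split_ifs with hi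
  · exact M.sum_vertices_ite_mem hface (t σ i)
  · exact Finset.sum_const_zero

end DiscreteManifold

theorem mainTheorem3 (n : ℕ) (hn : 2 ≤ n) (M : DiscreteManifold n)
    (ρ : Finset (EuclideanSpace ℝ (Fin n)) → ℝ)
    (hρ : ∀ σ ∈ M.simplices n, 0 < ρ σ)
    (f : EuclideanSpace ℝ (Fin n) → EuclideanSpace ℝ (Fin n))
    (hf : M.IsPiecewiseAffine f)
    (hnd : ∀ σ ∈ M.simplices n,
      Set.InjOn f (convexHull ℝ (σ : Set (EuclideanSpace ℝ (Fin n))))) :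
    M.stretchEnergy ρ f = ∑ σ ∈ M.simplices n, imageVolume f σ ^ 2 / mass ρ σ := by
  have h2 : (2 : ℝ) ≤ n := by exact_mod_cast hn
  have hn0 : (n : ℝ) ≠ 0 := by linarith
  have hn1 : (n : ℝ) - 1 ≠ 0 := by linarith
  rw [M.stretchEnergy_eq_sum_norm_sub_sq,
    M.sum_stretchWeight_mul ρ f fun x y => ‖f x - f y‖ ^ 2]
  simp only [Finset.mul_sum (s := M.simplices n)]
  refine Finset.sum_congr rfl fun σ hσ => ?_
  obtain ⟨hface, hcard⟩ := M.mem_simplices.1 hσ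
  obtain ⟨A, hA⟩ := hf σ hσ
  rw [sum_kVolume_image_mul_cot_dihedralAngle hn (M.complex.indep hface) hcard hA (hnd σ hσ),
    stretchFactor, one_div_div]
  -- The constants cancel: `1/n · 1/2 · 1/(n(n - 1)) · 2n²(n - 1) = 1`. The inverse stretch factor
  -- supplies the second power of the image volume.
  field_simp
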